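/- All graphs are finite and simple; $G+H$ denotes the disjoint union of $G$ and $H$, and $\overline{G}$ the complement of $G$. A graph is *$P_4$-sparse* if every set of at most five vertices induces at most one path $P_4$ on four vertices. A graph $G$ is *$(\infty,1)$-polar* if its vertex set has a partition $(A,B)$ (either part may be empty) such that $G[A]$ is a complete multipartite graph with any number of parts and $G[B]$ is a complete graph (a $1$-cluster). A *minimal $(\infty,1)$-polar obstruction* is a graph that is not $(\infty,1)$-polar while every proper induced subgraph of it is $(\infty,1)$-polar. A *cograph* is a graph that can be obtained from one-vertex graphs by disjoint unions and complementations. Let $G$ be a $P_4$-sparse graph. Then $G$ is a minimal $(\infty,1)$-polar obstruction if and only if $G$ is isomorphic to one of the following four graphs, each of which is a cograph: $$E_1=K_1+2K_2,\qquad E_2=2P_3,\qquad E_3=C_4+2K_1,\qquad E_7=K_1+\overline{P_3+K_2}.$$ -/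

import Mathlib

namespace P4Polar

open SimpleGraph

universe u

/-- `G` is `P₄`-sparse: any set of at most five vertices induces at most one `P₄`, that is, it
has at most one subset `W` for which `G[W]` is a path on four vertices. -/
def IsP4Sparse {V : Type u} (G : SimpleGraph V) : Prop :=
  ∀ S : Finset V, S.card ≤ 5 →
    {W : Finset V | W ⊆ S ∧ Nonempty (G.induce (W : Set V) ≃g pathGraph 4)}.Subsingleton

/-- `G` is a complete multipartite graph with at most `s` (nonempty) parts, `s = ⊤` meaning that
their number is unbounded. The parts are the classes of the relation "equal or nonadjacent". -/
def IsCompleteMultipartiteAtMost {V : Type u} (s : ℕ∞) (G : SimpleGraph V) : Prop :=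
  ∃ h : G.IsCompleteMultipartite, ENat.card (Quotient h.setoid) ≤ s

/-- `G` is a `k`-cluster: the complement of a complete `k`-partite graph (parts may be empty);
`k = ⊤` gives the clusters. -/
def IsCluster {V : Type u} (k : ℕ∞) (G : SimpleGraph V) : Prop :=
  IsCompleteMultipartiteAtMost k Gᶜ

/-- `(A, B)` is an `(s, k)`-polar partition of `G` (`A` or `B` may be empty). -/
def IsPolarPartition {V : Type u} (s k : ℕ∞) (G : SimpleGraph V) (A B : Set V) : Prop :=
  A ∪ B = Set.univ ∧ Disjoint A B ∧
    IsCompleteMultipartiteAtMost s (G.induce A) ∧ IsCluster k (G.induce B)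

/-- `G` is `(s, k)`-polar. -/
def IsPolar (s k : ℕ∞) {V : Type u} (G : SimpleGraph V) : Prop :=
  ∃ A B : Set V, IsPolarPartition s k G A B

/-- `G` is a minimal `P`-obstruction: `G` does not have the property `P`, but each of its proper
induced subgraphs does. -/
def IsMinimalObstruction (P : ∀ ⦃W : Type u⦄, SimpleGraph W → Prop) {V : Type u}
    (G : SimpleGraph V) : Prop :=
  ¬ P G ∧ ∀ S : Set V, S ≠ Set.univ → P (G.induce S)

/-- `G` is a minimal `(s, k)`-polar obstruction. -/
def IsMinimalPolarObstruction (s k : ℕ∞) {V : Type u} (G : SimpleGraph V) : Prop :=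
  IsMinimalObstruction (fun ⦃_⦄ H => IsPolar s k H) G

/-- Cographs: the graphs that are built from one-vertex graphs by disjoint union and complement
(up to isomorphism). -/
inductive IsCograph : {V : Type u} → SimpleGraph V → Prop
  | trivial {V : Type u} [Unique V] (G : SimpleGraph V) : IsCograph G
  | disjUnion {V W : Type u} {G : SimpleGraph V} {H : SimpleGraph W} :
      IsCograph G → IsCograph H → IsCograph (G ⊕g H)
  | compl {V : Type u} {G : SimpleGraph V} : IsCograph G → IsCograph Gᶜ
  | iso {V W : Type u} {G : SimpleGraph V} {H : SimpleGraph W} :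
      G ≃g H → IsCograph G → IsCograph H

/-- `E₁ = K₁ + 2K₂`. -/
def E1 : SimpleGraph (Fin 1 ⊕ (Fin 2 ⊕ Fin 2)) :=
  completeGraph (Fin 1) ⊕g (completeGraph (Fin 2) ⊕g completeGraph (Fin 2))

/-- `E₂ = 2P₃`. -/
def E2 : SimpleGraph (Fin 3 ⊕ Fin 3) :=
  pathGraph 3 ⊕g pathGraph 3

/-- `E₃ = C₄ + 2K₁`. -/
def E3 : SimpleGraph (Fin 4 ⊕ (Fin 1 ⊕ Fin 1)) :=
  cycleGraph 4 ⊕g (completeGraph (Fin 1) ⊕g completeGraph (Fin 1))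

/-- `E₇`, the disjoint union of `K₁` and the complement of `P₃ + K₂`. -/
def E7 : SimpleGraph (Fin 1 ⊕ (Fin 3 ⊕ Fin 2)) :=
  completeGraph (Fin 1) ⊕g (pathGraph 3 ⊕g completeGraph (Fin 2))ᶜ

end P4Polar

namespace P4Polar

open SimpleGraph

universe u

variable {V : Type u}

/-! Being $(\infty,1)$-polar means having a clique whose removal leaves a complete multipartite
graph (`HasPolarClique`). This is hereditary, so two facts suffice: the four graphs are minimal
non-polar, a finite check, and a finite `P4Uniform` graph without them is polar. $P_4$-sparseness is
used only through `P4Uniform`, which passes to complements.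

The second fact goes by induction on the number of vertices. A graph without induced $2K_2$ and
$C_4$ is split (`P4Uniform.exists_split`), and its independent side is a single part. Otherwise $G$
or its complement has an induced $2K_2$. A vertex sees nothing of it, only one of its edges, or all
of it, and these classes make $G$ or its complement disconnected (`FreeK1TwoK2.disconnects`,
`FreeTwoK2JoinK2.disconnects`).

Polarity passes to joins. In a disconnected graph without isolated vertices, excluding $E_1$ makes
both sides of a disconnection complete multipartite and excluding $E_2$ makes one of them a clique.
If $v$ is isolated, excluding $E_3$ and $E_7$ makes $G$ split or $G-v$ complete multipartite. -/

/-- `a b c d` is an induced path on four vertices. -/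
structure InducedP4 (G : SimpleGraph V) (a b c d : V) : Prop where
  ab : G.Adj a b
  bc : G.Adj b c
  cd : G.Adj c d
  ac : ¬ G.Adj a c
  ad : ¬ G.Adj a d
  bd : ¬ G.Adj b d

theorem inducedP4_iff {G : SimpleGraph V} {a b c d : V} : InducedP4 G a b c d ↔
    G.Adj a b ∧ G.Adj b c ∧ G.Adj c d ∧ ¬ G.Adj a c ∧ ¬ G.Adj a d ∧ ¬ G.Adj b d :=
  ⟨fun ⟨h1, h2, h3, h4, h5, h6⟩ => ⟨h1, h2, h3, h4, h5, h6⟩,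
    fun ⟨h1, h2, h3, h4, h5, h6⟩ => ⟨h1, h2, h3, h4, h5, h6⟩⟩

/-- `ab` and `cd` are the edges of an induced `2K₂`. -/
structure InducedTwoK2 (G : SimpleGraph V) (a b c d : V) : Prop where
  ab : G.Adj a b
  cd : G.Adj c d
  ac : ¬ G.Adj a c
  ad : ¬ G.Adj a d
  bc : ¬ G.Adj b c
  bd : ¬ G.Adj b d

/-- `a b c` is an induced path on three vertices. -/
structure InducedP3 (G : SimpleGraph V) (a b c : V) : Prop where
  ab : G.Adj a b
  bc : G.Adj b c
  ac : ¬ G.Adj a c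
  ne : a ≠ c

/-- A vertex outside an induced path `a b c d` sees nothing of it, all of it, or only its two
midpoints. -/
def P4Uniform (G : SimpleGraph V) : Prop :=
  ∀ a b c d v, InducedP4 G a b c d → v = a ∨ v = b ∨ v = c ∨ v = d ∨
    ((G.Adj v a ↔ G.Adj v d) ∧ (G.Adj v b ↔ G.Adj v c) ∧ (G.Adj v a → G.Adj v b))

/-! ### From $P_4$-sparse to $P_4$-uniform -/

theorem exists_embedding_of_adj_iff {W : Type*} {H : SimpleGraph W} {G : SimpleGraph V} (f : W → V)
    (hf : ∀ x y, x ≠ y → f x ≠ f y) (h : ∀ x y, G.Adj (f x) (f y) ↔ H.Adj x y) :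
    ∃ e : H ↪g G, ⇑e = f :=
  ⟨⟨⟨f, fun x y hxy => by_contra fun hne => hf x y hne hxy⟩, h _ _⟩, rfl⟩

theorem InducedP4.exists_embedding {G : SimpleGraph V} {a b c d : V} (h : InducedP4 G a b c d) :
    ∃ f : pathGraph 4 ↪g G, ⇑f = ![a, b, c, d] := by
  obtain ⟨h1, h2, h3, h4, h5, h6⟩ := h
  have n1 := h1.ne
  have n2 := h2.ne
  have n3 := h3.ne
  have n4 : a ≠ c := by rintro rfl; exact h5 h3
  have n5 : a ≠ d := by rintro rfl; exact h4 h3.symm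
  have n6 : b ≠ d := by rintro rfl; exact h5 h1
  apply exists_embedding_of_adj_iff
  · intro i j
    fin_cases i <;> fin_cases j <;> simp [n1, n2, n3, n4, n5, n6, n1.symm, n2.symm, n3.symm,
      n4.symm, n5.symm, n6.symm]
  · intro i j
    fin_cases i <;> fin_cases j <;> simp [pathGraph_adj, h1, h2, h3, h4, h5, h6,
      h1.symm, h2.symm, h3.symm, mt G.adj_symm h4, mt G.adj_symm h5, mt G.adj_symm h6]

theorem IsP4Sparse.mem_of_mem {G : SimpleGraph V} (hG : IsP4Sparse G) {a b c d p q r s : V}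
    (v : V) (h : InducedP4 G a b c d) (h' : InducedP4 G p q r s)
    (hs : ∀ x ∈ ({p, q, r, s} : Set V), x ∈ ({a, b, c, d, v} : Set V)) :
    ∀ x ∈ ({p, q, r, s} : Set V), x ∈ ({a, b, c, d} : Set V) := by
  classical
  obtain ⟨f, hf⟩ := h.exists_embedding
  obtain ⟨g, hg⟩ := h'.exists_embedding
  have key : ∀ (e : pathGraph 4 ↪g G),
      Nonempty (G.induce (((Finset.univ.map e.toEmbedding : Finset V)) : Set V) ≃g
        pathGraph 4) := by
    intro e
    have : ((Finset.univ.map e.toEmbedding : Finset V) : Set V) = Set.range e := by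
      ext; simp
    rw [this]
    exact ⟨(Embedding.isoInduceRange e).symm⟩
  have hfr : ∀ x, x ∈ (Finset.univ.map f.toEmbedding : Finset V) ↔
      x ∈ ({a, b, c, d} : Set V) := by
    intro x
    simp [hf, Fin.exists_fin_succ, eq_comm]
  have hgr : ∀ x, x ∈ (Finset.univ.map g.toEmbedding : Finset V) ↔
      x ∈ ({p, q, r, s} : Set V) := by
    intro x
    simp [hg, Fin.exists_fin_succ, eq_comm]
  have := hG {a, b, c, d, v} Finset.card_le_five
    (x := Finset.univ.map f.toEmbedding) ⟨?_, key f⟩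
    (y := Finset.univ.map g.toEmbedding) ⟨?_, key g⟩
  · intro x hx
    rw [← hfr, this, hgr]
    exact hx
  · intro x hx
    rw [hfr] at hx
    simp at hx ⊢
    tauto
  · intro x hx
    rw [hgr] at hx
    simpa using hs x hx

theorem IsP4Sparse.p4Uniform {G : SimpleGraph V} (hG : IsP4Sparse G) : P4Uniform G := by
  intro a b c d v h
  by_contra! hc
  obtain ⟨va, vb, vc, vd, hc⟩ := hc
  have key : ∀ p q r s, (∀ x ∈ ({p, q, r, s} : Set V), x ∈ ({a, b, c, d, v} : Set V)) →
      v ∈ ({p, q, r, s} : Set V) → ¬ InducedP4 G p q r s := by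
    intro p q r s hs hv h'
    have := hG.mem_of_mem v h h' hs v hv
    simp [va, vb, vc, vd] at this
  -- Each forbidden adjacency pattern of `v` creates one of these eight paths through `v`, a second
  -- $P_4$ on the five vertices.
  have k1 := key v a b c (by simp) (by simp)
  have k2 := key v b c d (by simp) (by simp)
  have k3 := key v c b a (by simp) (by simp)
  have k4 := key v d c b (by simp) (by simp)
  have k5 := key a v c d (by simp) (by simp)
  have k6 := key a b v d (by simp) (by simp)
  have k7 := key a v d c (by simp) (by simp)
  have k8 := key b a v d (by simp) (by simp)
  obtain ⟨h1, h2, h3, h4, h5, h6⟩ := h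
  simp only [inducedP4_iff, G.adj_comm _ v, G.adj_comm b a, G.adj_comm c a,
    G.adj_comm c b, G.adj_comm d b, G.adj_comm d c, h1, h2, h3, h4, h5, h6]
    at k1 k2 k3 k4 k5 k6 k7 k8
  clear key
  by_cases h7 : G.Adj v a <;> by_cases h8 : G.Adj v b <;> by_cases h9 : G.Adj v c <;>
    by_cases h10 : G.Adj v d <;> simp_all

theorem P4Uniform.compl {G : SimpleGraph V} (h : P4Uniform G) : P4Uniform Gᶜ := by
  intro a b c d v hp
  obtain ⟨h1, h2, h3, h4, h5, h6⟩ := hp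
  have n4 : a ≠ c := by rintro rfl; exact h5 h3
  have n5 : a ≠ d := by rintro rfl; exact h4 h3.symm
  have n6 : b ≠ d := by rintro rfl; exact h5 h1
  simp only [compl_adj] at *
  -- The complement of a $P_4$ is a $P_4$ with ends and midpoints exchanged.
  have := h c a d b v ⟨by grind [G.adj_comm], by grind, by grind [G.adj_comm], by grind [G.adj_comm],
    by grind [G.adj_comm], by grind⟩
  grind

/-! ### Disconnection around an induced $2K_2$ -/

/-- There is a nonempty proper set of vertices with no edge leaving it. -/
def Disconnects (G : SimpleGraph V) : Prop :=
  ∃ X : Set V, X.Nonempty ∧ Xᶜ.Nonempty ∧ ∀ x ∈ X, ∀ y ∉ X, ¬ G.Adj x y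

/-- No five vertices induce `K₁ + 2K₂`. -/
def FreeK1TwoK2 (G : SimpleGraph V) : Prop :=
  ∀ a b c d v, InducedTwoK2 G a b c d → G.Adj v a ∨ G.Adj v b ∨ G.Adj v c ∨ G.Adj v d

/-- No six vertices induce `2P₃`. -/
def FreeTwoP3 (G : SimpleGraph V) : Prop :=
  ∀ a b c x y z, InducedP3 G a b c → InducedP3 G x y z →
    (∀ p ∈ ({a, b, c} : Set V), ∀ q ∈ ({x, y, z} : Set V), ¬ G.Adj p q) → False

/-- No six vertices induce the join of `2K₂` and `K₂`. -/
def FreeTwoK2JoinK2 (G : SimpleGraph V) : Prop :=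
  ∀ a b c d u v, InducedTwoK2 G a b c d →
    (∀ p ∈ ({a, b, c, d} : Set V), G.Adj u p ∧ G.Adj v p) → ¬ G.Adj u v

/-- No six vertices induce the join of `P₃ + K₂` and `K₁`. -/
def FreeP3K2JoinK1 (G : SimpleGraph V) : Prop :=
  ∀ a b c d e v, InducedP3 G a b c → G.Adj d e →
    (∀ p ∈ ({a, b, c} : Set V), ∀ q ∈ ({d, e} : Set V), ¬ G.Adj p q) →
    ¬ ∀ p ∈ ({a, b, c, d, e} : Set V), G.Adj v p

/-- In a `P₄`-uniform graph, a vertex seeing both edges of an induced `2K₂` sees all of it. -/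
theorem P4Uniform.complete_of_adj {G : SimpleGraph V} (h : P4Uniform G) {a b c d v : V}
    (h2 : InducedTwoK2 G a b c d) (hab : G.Adj v a ∨ G.Adj v b) (hcd : G.Adj v c ∨ G.Adj v d) :
    G.Adj v a ∧ G.Adj v b ∧ G.Adj v c ∧ G.Adj v d := by
  obtain ⟨h1, h2, h3, h4, h5, h6⟩ := h2
  have key : ∀ p q r s, G.Adj v p → G.Adj v q → G.Adj p r → G.Adj q s → ¬ G.Adj p q →
      ¬ G.Adj p s → ¬ G.Adj r q → ¬ G.Adj r s → G.Adj v r := by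
    intro p q r s e1 e2 e3 e4 e5 e6 e7 e8
    -- Otherwise `r p v q` is an induced $P_4$, and `s` sees its end `q` but not its end `r`.
    by_contra hvr
    by_cases hvs : G.Adj v s
    · have := h r p v q s ⟨e3.symm, e1.symm, e2, mt G.adj_symm hvr, e7, e5⟩
      grind [G.adj_comm, G.loopless.irrefl]
    · have := h r p v q s ⟨e3.symm, e1.symm, e2, mt G.adj_symm hvr, e7, e5⟩
      grind [G.adj_comm, G.loopless.irrefl]
  grind [G.adj_comm]

/-- Otherwise `x y r c` is an induced $P_4$ of which `d` sees the midpoint `r` but not the midpoint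
`y`. -/
theorem P4Uniform.adj_of_path {G : SimpleGraph V} (h : P4Uniform G) {x y r c d : V}
    (hxy : G.Adj x y) (hyr : G.Adj y r) (hrc : G.Adj r c) (hrd : G.Adj r d) (hcd : c ≠ d)
    (hxc : ¬ G.Adj x c) (hxd : ¬ G.Adj x d) (hyc : ¬ G.Adj y c) (hyd : ¬ G.Adj y d) :
    G.Adj x r := by
  by_contra hxr
  have := h x y r c d ⟨hxy, hyr, hrc, hxr, hxc, hyc⟩
  grind [G.adj_comm, G.loopless.irrefl]

/-- A vertex complete to an induced `2K₂` is adjacent to every vertex that sees only its edge `ab`. -/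
theorem P4Uniform.adj_of_sees_left {G : SimpleGraph V} (h : P4Uniform G) {a b c d r u : V}
    (h2 : InducedTwoK2 G a b c d) (hr : G.Adj r a ∧ G.Adj r b ∧ G.Adj r c ∧ G.Adj r d)
    (hu : G.Adj u a ∨ G.Adj u b) (huc : ¬ G.Adj u c) (hud : ¬ G.Adj u d) : G.Adj u r := by
  obtain ⟨ra, rb, rc, rd⟩ := hr
  rcases hu with hu | hu
  · exact h.adj_of_path hu ra.symm rc rd h2.cd.ne huc hud h2.ac h2.ad
  · exact h.adj_of_path hu rb.symm rc rd h2.cd.ne huc hud h2.bc h2.bd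

theorem InducedTwoK2.swap {G : SimpleGraph V} {a b c d : V} (h : InducedTwoK2 G a b c d) :
    InducedTwoK2 G c d a b :=
  ⟨h.cd, h.ab, mt G.adj_symm h.ac, mt G.adj_symm h.bc, mt G.adj_symm h.ad, mt G.adj_symm h.bd⟩

/-- Vertices that see different edges of an induced `2K₂` only are not adjacent. -/
theorem P4Uniform.not_adj_of_sees {G : SimpleGraph V} (h : P4Uniform G) {a b c d u w : V}
    (h2 : InducedTwoK2 G a b c d)
    (hu : G.Adj u a ∨ G.Adj u b) (huc : ¬ G.Adj u c) (hud : ¬ G.Adj u d)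
    (hw : G.Adj w c ∨ G.Adj w d) (hwa : ¬ G.Adj w a) (hwb : ¬ G.Adj w b) : ¬ G.Adj u w := by
  intro huw
  obtain ⟨h1, h2, h3, h4, h5, h6⟩ := h2
  have key : ∀ p q r, G.Adj u p → G.Adj p q → G.Adj w r → ¬ G.Adj u r → ¬ G.Adj w p →
      ¬ G.Adj p r → ¬ G.Adj q r → ¬ G.Adj w q → False := by
    intro p q r e1 e2 e3 e4 e5 e6 e7 e8
    have := h p u w r q ⟨e1.symm, huw, e3, mt G.adj_symm e5, e6, e4⟩
    grind [G.adj_comm, G.loopless.irrefl]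
  grind [G.adj_comm]

/-- Every vertex sees the $2K_2$. Those complete to it, if any, are joined to all others; if there
are none, the vertices seeing `ab` and those seeing `cd` partition the graph with no edge between.
-/
theorem FreeK1TwoK2.disconnects {G : SimpleGraph V} (h : P4Uniform G) (hE : FreeK1TwoK2 G)
    {a b c d : V} (h2 : InducedTwoK2 G a b c d) : Disconnects G ∨ Disconnects Gᶜ := by
  by_cases hR : ∃ r, G.Adj r a ∧ G.Adj r b ∧ G.Adj r c ∧ G.Adj r d
  · right
    refine ⟨{r | G.Adj r a ∧ G.Adj r b ∧ G.Adj r c ∧ G.Adj r d}, hR,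
      ⟨a, fun ha => G.irrefl ha.1⟩, ?_⟩
    intro r hr v hv hrv
    apply (compl_adj _ _ _ |>.1 hrv).2
    by_cases hab : G.Adj v a ∨ G.Adj v b
    · by_cases hcd : G.Adj v c ∨ G.Adj v d
      · exact absurd (h.complete_of_adj h2 hab hcd) hv
      · rw [not_or] at hcd
        exact (h.adj_of_sees_left h2 hr hab hcd.1 hcd.2).symm
    · have hcd : G.Adj v c ∨ G.Adj v d := by have := hE a b c d v h2; tauto
      rw [not_or] at hab
      exact (h.adj_of_sees_left h2.swap ⟨hr.2.2.1, hr.2.2.2, hr.1, hr.2.1⟩ hcd hab.1 hab.2).symm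
  · left
    refine ⟨{v | (G.Adj v a ∨ G.Adj v b) ∧ ¬ G.Adj v c ∧ ¬ G.Adj v d},
      ⟨a, .inr h2.ab, h2.ac, h2.ad⟩, ⟨c, fun hc => hc.2.2 h2.cd⟩, ?_⟩
    rintro u ⟨hu, huc, hud⟩ w hw huw
    have hx := fun p q => hR ⟨w, h.complete_of_adj h2 p q⟩
    have hy := hE a b c d w h2
    simp only [Set.mem_ofPred_eq] at hw
    refine h.not_adj_of_sees h2 hu huc hud ?_ ?_ ?_ huw <;> tauto

/-- Here vertices may miss the $2K_2$, but the set `R` of vertices complete to it is independent.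
When `R` is nonempty, the vertices outside `R` without neighbours in `R` are cut off from the rest,
or there are none and `R` is joined to everything else. -/
theorem FreeTwoK2JoinK2.disconnects {G : SimpleGraph V} (h : P4Uniform G) (hE : FreeTwoK2JoinK2 G)
    {a b c d : V} (h2 : InducedTwoK2 G a b c d) : Disconnects G ∨ Disconnects Gᶜ := by
  set R : Set V := {r | G.Adj r a ∧ G.Adj r b ∧ G.Adj r c ∧ G.Adj r d} with hRdef
  have hRR : ∀ r ∈ R, ∀ s ∈ R, ¬ G.Adj r s := by
    rintro r ⟨r1, r2, r3, r4⟩ s ⟨s1, s2, s3, s4⟩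
    exact hE a b c d r s h2 (by simp [*])
  have hA : ∀ r ∈ R, ∀ v, (G.Adj v a ∨ G.Adj v b) → ¬ G.Adj v c → ¬ G.Adj v d → G.Adj v r :=
    fun r hr v hu hc hd => h.adj_of_sees_left h2 hr hu hc hd
  have hB : ∀ r ∈ R, ∀ v, (G.Adj v c ∨ G.Adj v d) → ¬ G.Adj v a → ¬ G.Adj v b → G.Adj v r :=
    fun r hr v hu hc hd =>
      h.adj_of_sees_left h2.swap ⟨hr.2.2.1, hr.2.2.2, hr.1, hr.2.1⟩ hu hc hd
  have hC := fun v => h.complete_of_adj (v := v) h2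
  by_cases hR : R.Nonempty
  · have hT : ∀ v ∉ R, ∀ r ∈ R, ∀ s ∈ R, G.Adj v r → G.Adj v s := by
      intro v hv r hr s hs hvr
      by_contra hvs
      have hAv := hA s hs v
      have hBv := hB s hs v
      have hCv := hC v
      have hva : ¬ G.Adj v a := by simp only [R, Set.mem_ofPred_eq] at hv; tauto
      have hvb : ¬ G.Adj v b := by simp only [R, Set.mem_ofPred_eq] at hv; tauto
      -- `b` sees the end `s` of the path `v r a s` but not its end `v`.
      have := h v r a s b ⟨hvr, hr.1, hs.1.symm, hva, hvs, hRR r hr s hs⟩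
      have := hs.2.1
      have := hr.2.1
      have := h2.ab
      grind [G.adj_comm, G.loopless.irrefl]
    obtain ⟨r, hr⟩ := hR
    by_cases hZ : ∃ z ∉ R, ∀ s ∈ R, ¬ G.Adj z s
    · left
      refine ⟨{z | z ∉ R ∧ ∀ s ∈ R, ¬ G.Adj z s}, hZ, ⟨r, fun hr' => hr'.1 hr⟩, ?_⟩
      rintro z ⟨hzR, hz⟩ y hy hzy
      simp only [Set.mem_ofPred_eq, not_and, not_forall, not_not] at hy
      have hyR : y ∉ R := fun hyR => hz y hyR hzy
      obtain ⟨s, hs, hys⟩ := hy hyR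
      have hzs := hz s hs
      have hza : ¬ (G.Adj z a ∨ G.Adj z b) := fun hza => by
        have := hA s hs z hza; have := hC z hza; simp only [R, Set.mem_ofPred_eq] at hzR; tauto
      have hzc : ¬ (G.Adj z c ∨ G.Adj z d) := fun hzc => by
        have := hB s hs z hzc; tauto
      rw [not_or] at hza hzc
      by_cases hya : G.Adj y a ∨ G.Adj y b
      · by_cases hyc : G.Adj y c ∨ G.Adj y d
        · exact hyR (hC y hya hyc)
        · rw [not_or] at hyc
          exact hzs (h.adj_of_path hzy hys hs.2.2.1 hs.2.2.2 h2.cd.ne hzc.1 hzc.2 hyc.1 hyc.2)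
      · rw [not_or] at hya
        exact hzs (h.adj_of_path hzy hys hs.1 hs.2.1 h2.ab.ne hza.1 hza.2 hya.1 hya.2)
    · right
      refine ⟨R, ⟨r, hr⟩, ⟨a, fun ha => G.irrefl ha.1⟩, ?_⟩
      intro s hs v hv hsv
      apply (compl_adj _ _ _ |>.1 hsv).2
      push Not at hZ
      obtain ⟨t, ht, hvt⟩ := hZ v hv
      exact (hT v hv t ht s hs hvt).symm
  · left
    have hC' : ∀ v, ¬ ((G.Adj v a ∨ G.Adj v b) ∧ (G.Adj v c ∨ G.Adj v d)) :=
      fun v hv => hR ⟨v, hC v hv.1 hv.2⟩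
    set A : Set V := {v | G.Adj v a ∨ G.Adj v b} with hAdef
    set B : Set V := {v | G.Adj v c ∨ G.Adj v d} with hBdef
    have hAB : ∀ u ∈ A, ∀ w ∈ B, ¬ G.Adj u w := by
      intro u hu w hw
      have h3 := hC' u
      have h4 := hC' w
      have hu' : G.Adj u a ∨ G.Adj u b := hu
      have hw' : G.Adj w c ∨ G.Adj w d := hw
      refine h.not_adj_of_sees h2 hu ?_ ?_ hw ?_ ?_ <;> tauto
    -- Since `A` may have neighbours that miss the whole $2K_2$, the separated set is `A` together
    -- with its neighbours outside `B`.
    refine ⟨{v | v ∉ B ∧ (v ∈ A ∨ ∃ u ∈ A, G.Adj v u)}, ⟨a, fun ha => hC' a ⟨.inr h2.ab, ha⟩,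
      .inl (.inr h2.ab)⟩, ⟨c, fun hc => hc.1 (.inr h2.cd)⟩, ?_⟩
    rintro t ⟨htB, ht⟩ w hw htw
    simp only [Set.mem_ofPred_eq, not_and, not_or, not_exists] at hw
    by_cases htA : t ∈ A
    · exact (hw (hAB t htA w · htw)).2 t htA htw.symm
    · obtain ⟨u, hu, htu⟩ := ht.resolve_left htA
      have huB : u ∉ B := fun hu' => hC' u ⟨hu, hu'⟩
      by_cases hwB : w ∈ B
      · have hwA : w ∉ A := fun hw' => hC' w ⟨hw', hwB⟩
        have huw := hAB u hu w hwB
        have key : ∀ p ∈ A, p ∉ B → ∀ q ∈ B, q ∉ A → G.Adj u p → G.Adj w q → ¬ G.Adj t p →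
            ¬ G.Adj t q → False := by
          intro p hp hpB q hq hqA hup hwq htp htq
          have e1 := hAB p hp w hwB
          have e2 := hAB p hp q hq
          have e3 := hAB u hu q hq
          have := h u t w q p ⟨htu.symm, htw, hwq, huw, e3, htq⟩
          grind [G.adj_comm, G.loopless.irrefl]
        have ha : a ∈ A ∧ a ∉ B := ⟨.inr h2.ab, fun ha => hC' a ⟨.inr h2.ab, ha⟩⟩
        have hb : b ∈ A ∧ b ∉ B := ⟨.inl h2.ab.symm, fun ha => hC' b ⟨.inl h2.ab.symm, ha⟩⟩
        have hc : c ∈ B ∧ c ∉ A := ⟨.inr h2.cd, fun ha => hC' c ⟨ha, .inr h2.cd⟩⟩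
        have hd : d ∈ B ∧ d ∉ A := ⟨.inl h2.cd.symm, fun ha => hC' d ⟨ha, .inl h2.cd.symm⟩⟩
        have hta : ¬ G.Adj t a ∧ ¬ G.Adj t b := not_or.1 htA
        have htc : ¬ G.Adj t c ∧ ¬ G.Adj t d := not_or.1 htB
        have hu' : G.Adj u a ∨ G.Adj u b := hu
        have hw' : G.Adj w c ∨ G.Adj w d := hwB
        grind
      · obtain ⟨hwA, hwu⟩ := hw hwB
        have hwu : ¬ G.Adj w u := hwu u hu
        have hta : ¬ G.Adj t a ∧ ¬ G.Adj t b := not_or.1 htA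
        have hwa : ¬ G.Adj w a ∧ ¬ G.Adj w b := not_or.1 hwA
        have hab := h2.ab
        have key : ∀ p q, G.Adj u p → G.Adj p q → ¬ G.Adj t p → ¬ G.Adj t q → ¬ G.Adj w p →
            ¬ G.Adj w q → False := by
          intro p q e1 e2 e3 e4 e5 e6
          have := h w t u p q ⟨htw.symm, htu, e1, hwu, e5, e3⟩
          grind [G.adj_comm, G.loopless.irrefl]
        have hu' : G.Adj u a ∨ G.Adj u b := hu
        grind [G.adj_comm]

/-- A `P₄`-uniform graph with an induced `2K₂` that no vertex is complete to, and without induced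
`P₃ + K₂`, has no induced `P₃`. -/
theorem P4Uniform.not_inducedP3 {G : SimpleGraph V} (h : P4Uniform G) {a b c d : V}
    (h2 : InducedTwoK2 G a b c d)
    (hE : ∀ v, ¬ (G.Adj v a ∧ G.Adj v b ∧ G.Adj v c ∧ G.Adj v d))
    (hP : ∀ p q r s t, InducedP3 G p q r → G.Adj s t →
      ¬ ∀ x ∈ ({p, q, r} : Set V), ∀ y ∈ ({s, t} : Set V), ¬ G.Adj x y) (x y z : V) :
    ¬ InducedP3 G x y z := by
  have hC : ∀ v, ¬ ((G.Adj v a ∨ G.Adj v b) ∧ (G.Adj v c ∨ G.Adj v d)) :=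
    fun v hv => hE v (h.complete_of_adj h2 hv.1 hv.2)
  -- Seeing an edge of the $2K_2$ propagates along adjacency: otherwise `w`, `u` and an end of that
  -- edge form a $P_3$ anticomplete to the other edge. As an induced $P_3$ must touch both edges,
  -- its midpoint then sees both.
  have step : ∀ {a b c d : V}, InducedTwoK2 G a b c d →
      (∀ v, ¬ ((G.Adj v a ∨ G.Adj v b) ∧ (G.Adj v c ∨ G.Adj v d))) →
      ∀ u w, G.Adj u w → (G.Adj u a ∨ G.Adj u b) → (G.Adj w a ∨ G.Adj w b) := by
    intro a b c d h2 hC u w huw hu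
    have h3 := hC u
    have h4 := hC w
    have h5 := h2.ac
    have h6 := h2.ad
    have h7 := h2.bc
    have h8 := h2.bd
    by_contra hw
    by_cases hwc : G.Adj w c ∨ G.Adj w d
    · refine h.not_adj_of_sees h2 hu ?_ ?_ hwc ?_ ?_ huw <;> tauto
    · rcases hu with hu | hu
      · refine hP w u a c d ⟨huw.symm, hu, by tauto, ?_⟩ h2.cd (by simp; tauto)
        rintro rfl; exact hw (.inr h2.ab)
      · refine hP w u b c d ⟨huw.symm, hu, by tauto, ?_⟩ h2.cd (by simp; tauto)
        rintro rfl; exact hw (.inl h2.ab.symm)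
  rintro h3
  have s1 := step h2 hC
  have s2 := step h2.swap (fun v hv => hC v hv.symm)
  have t1 := hP x y z a b h3 h2.ab
  have t2 := hP x y z c d h3 h2.cd
  simp only [Set.mem_insert_iff, Set.mem_singleton_iff, forall_eq_or_imp, forall_eq] at t1 t2
  refine hC y ⟨?_, ?_⟩
  · by_contra hn
    have hx := mt (s1 x y h3.ab) hn
    have hz := mt (s1 z y h3.bc.symm) hn
    rw [not_or] at hx hz hn
    exact t1 ⟨hx, hn, hz⟩
  · by_contra hn
    have hx := mt (s2 x y h3.ab) hn
    have hz := mt (s2 z y h3.bc.symm) hn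
    rw [not_or] at hx hz hn
    exact t2 ⟨hx, hn, hz⟩

/-! ### Split graphs -/

/-- Földes and Hammer, for `P₄`-uniform graphs: without induced `2K₂` and `C₄` they are split. -/
theorem P4Uniform.exists_split [Finite V] {G : SimpleGraph V} (h : P4Uniform G)
    (h2 : ∀ a b c d, ¬ InducedTwoK2 G a b c d) (h4 : ∀ a b c d, ¬ InducedTwoK2 Gᶜ a b c d) :
    ∃ K : Set V, G.IsClique K ∧ ∀ x ∉ K, ∀ y ∉ K, ¬ G.Adj x y := by
  classical
  have := Fintype.ofFinite V
  have hC4 : ∀ a b c d, G.Adj a b → G.Adj b c → G.Adj c d → G.Adj d a → a ≠ c → b ≠ d →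
      G.Adj a c ∨ G.Adj b d := by
    intro a b c d e1 e2 e3 e4 n1 n2
    by_contra! hn
    refine h4 a c b d ⟨?_, ?_, ?_, ?_, ?_, ?_⟩ <;> simp only [compl_adj] <;> grind [G.adj_comm]
  -- The summand `Fintype.card V` exceeds every degree, so trading one vertex for two raises the
  -- weight; one-for-one trades compare degrees.
  obtain ⟨K, hK, hmax⟩ := Finset.exists_max_image
    (Finset.univ.filter fun K : Finset V => G.IsClique (K : Set V))
    (fun K => ∑ v ∈ K, (G.degree v + Fintype.card V)) ⟨∅, by simp⟩
  simp only [Finset.mem_filter, Finset.mem_univ, true_and] at hK hmax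
  refine ⟨K, hK, ?_⟩
  intro x hx y hy hxy
  simp only [Finset.mem_coe] at hx hy
  have hKK : ∀ u ∈ K, ∀ v ∈ K, u ≠ v → G.Adj u v := fun u hu v hv => hK hu hv
  have pos : ∀ v : V, 0 < Fintype.card V := fun v => Fintype.card_pos_iff.2 ⟨v⟩
  have hnon : ∀ x ∉ K, ∃ u ∈ K, ¬ G.Adj x u := by
    intro x hx
    by_contra! hc
    have := hmax (insert x K) (by
      rw [Finset.coe_insert]
      exact hK.insert fun b hb _ => hc b hb)
    rw [Finset.sum_insert hx] at this
    have := pos x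
    omega
  have swap : ∀ x ∉ K, ∀ u ∈ K, (∀ w ∈ K, w ≠ u → G.Adj x w) → G.degree x ≤ G.degree u := by
    intro x hx u hu hc
    have hxu : x ∉ K.erase u := fun h => hx (Finset.mem_of_mem_erase h)
    have := hmax (insert x (K.erase u)) (by
      rw [Finset.coe_insert]
      refine (hK.subset (by simp)).insert fun b hb _ => ?_
      simp at hb
      exact hc b hb.1 hb.2)
    rw [Finset.sum_insert hxu, ← Finset.add_sum_erase _ _ hu] at this
    omega
  have swap2 : ∀ x ∉ K, ∀ y ∉ K, G.Adj x y → ∀ u ∈ K, (∀ w ∈ K, w ≠ u → G.Adj x w) →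
      (∀ w ∈ K, w ≠ u → G.Adj y w) → False := by
    intro x hx y hy hxy u hu hcx hcy
    have hxu : x ∉ K.erase u := fun h => hx (Finset.mem_of_mem_erase h)
    have hyu : y ∉ insert x (K.erase u) := by
      simp [hxy.ne.symm, hy]
    have := hmax (insert y (insert x (K.erase u))) (by
      rw [Finset.coe_insert, Finset.coe_insert]
      refine ((hK.subset (by simp)).insert fun b hb _ => ?_).insert fun b hb _ => ?_
      · simp at hb
        exact hcx b hb.1 hb.2
      · simp at hb
        rcases hb with rfl | hb
        · exact hxy.symm
        · exact hcy b hb.1 hb.2)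
    rw [Finset.sum_insert hyu, Finset.sum_insert hxu, ← Finset.add_sum_erase _ _ hu] at this
    have := G.degree_lt_card_verts u
    omega
  have main : ∀ x ∉ K, ∀ y ∉ K, G.Adj x y → (∀ u ∈ K, ¬ G.Adj x u → ¬ G.Adj y u) → False := by
    intro x hx y hy hxy hsub
    obtain ⟨u, hu, hxu⟩ := hnon x hx
    have hyu := hsub u hu hxu
    have hcx : ∀ w ∈ K, w ≠ u → G.Adj x w := by
      intro w hw hwu
      by_contra hxw
      exact h2 x y u w ⟨hxy, hKK u hu w hw hwu.symm, hxu, hxw, hyu, hsub w hw hxw⟩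
    obtain ⟨w, hw, hwu, hyw⟩ : ∃ w ∈ K, w ≠ u ∧ ¬ G.Adj y w := by
      by_contra! hc
      exact swap2 x hx y hy hxy u hu hcx hc
    obtain ⟨z, huz, hxz⟩ : ∃ z, G.Adj u z ∧ ¬ G.Adj x z := by
      by_contra! hc
      have hlt : G.neighborFinset u ⊂ G.neighborFinset x := by
        refine Finset.ssubset_iff_subset_ne.2 ⟨fun z hz => ?_, fun heq => ?_⟩
        · simp at hz ⊢; exact hc z hz
        · have : y ∈ G.neighborFinset u := by rw [heq]; simpa using hxy
          simp at this
          exact hyu this.symm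
      have := Finset.card_lt_card hlt
      have := swap x hx u hu hcx
      simp only [card_neighborFinset_eq_degree] at *
      omega
    have hyz : G.Adj y z := by
      by_contra hyz
      exact h2 x y u z ⟨hxy, huz, hxu, hxz, hyu, hyz⟩
    have hxw := hcx w hw hwu
    have huw := hKK w hw u hu hwu
    have := hC4 w x y z hxw.symm hxy hyz
    -- `w` sees both ends of the path `x y z u` but not its midpoint `y`.
    have := h x y z u w ⟨hxy, hyz, huz.symm, hxz, hxu, hyu⟩
    grind [G.adj_comm, G.loopless.irrefl]
  by_cases hs : ∀ u ∈ K, ¬ G.Adj x u → ¬ G.Adj y u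
  · exact main x hx y hy hxy hs
  by_cases hs' : ∀ u ∈ K, ¬ G.Adj y u → ¬ G.Adj x u
  · exact main y hy x hx hxy.symm hs'
  push Not at hs hs'
  obtain ⟨u, hu, hxu, hyu⟩ := hs
  obtain ⟨v, hv, hyv, hxv⟩ := hs'
  have huv : u ≠ v := by rintro rfl; exact hxu hxv
  exact (hC4 x y u v hxy hyu (hKK u hu v hv huv) hxv.symm (ne_of_mem_of_not_mem hu hx).symm
    (ne_of_mem_of_not_mem hv hy).symm).elim hxu hyv

/-! ### Polar cliques in disconnected graphs -/

/-- A clique whose complement induces a complete multipartite graph. -/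
def HasPolarClique (G : SimpleGraph V) : Prop :=
  ∃ B : Set V, G.IsClique B ∧
    ∀ x ∉ B, ∀ y ∉ B, ∀ z ∉ B, ¬ G.Adj x y → ¬ G.Adj y z → ¬ G.Adj x z

theorem hasPolarClique_of_split {G : SimpleGraph V}
    (h : ∃ K : Set V, G.IsClique K ∧ ∀ x ∉ K, ∀ y ∉ K, ¬ G.Adj x y) : HasPolarClique G := by
  obtain ⟨K, hK, hI⟩ := h
  exact ⟨K, hK, fun x hx _ _ z hz _ _ => hI x hx z hz⟩

theorem P4Uniform.induce {G : SimpleGraph V} (h : P4Uniform G) (X : Set V) :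
    P4Uniform (G.induce X) := by
  rintro a b c d v ⟨h1, h2, h3, h4, h5, h6⟩
  simpa only [Subtype.ext_iff, comap_adj, Function.Embedding.subtype_apply] using h a b c d v ⟨h1, h2, h3, h4, h5, h6⟩

/-- If one side of a disconnection has no induced `P₃`, and nonadjacency is transitive on both
sides, the first side is a clique or edgeless. -/
theorem hasPolarClique_of_side {G : SimpleGraph V} {X : Set V}
    (hX : ∀ x ∈ X, ∀ y ∈ X, ∀ z ∈ X, ¬ G.Adj x y → ¬ G.Adj y z → ¬ G.Adj x z)
    (hX' : ∀ x ∉ X, ∀ y ∉ X, ∀ z ∉ X, ¬ G.Adj x y → ¬ G.Adj y z → ¬ G.Adj x z)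
    (he : ∃ x ∈ X, ∃ y ∈ X, G.Adj x y)
    (hP : ∀ x ∈ X, ∀ y ∈ X, ∀ z ∈ X, ¬ InducedP3 G x y z) : HasPolarClique G := by
  refine ⟨X, ?_, hX'⟩
  obtain ⟨x, hx, y, hy, hxy⟩ := he
  have hxz : ∀ z ∈ X, z ≠ x → G.Adj x z := by
    intro z hz hzx
    by_contra hc
    have h1 := hX y hy z hz x hx
    have h2 := hP x hx y hy z hz
    by_cases hyz : G.Adj y z
    · exact h2 ⟨hxy, hyz, hc, hzx.symm⟩
    · exact h1 hyz (mt G.adj_symm hc) hxy.symm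
  intro p hp q hq hpq
  by_contra hc
  by_cases h1 : p = x
  · subst h1; exact hc (hxz q hq hpq.symm)
  by_cases h2 : q = x
  · subst h2; exact hc (hxz p hp hpq).symm
  exact hP p hp x hx q hq ⟨(hxz p hp h1).symm, hxz q hq h2, hc, hpq⟩

/-- The vertex `v` is universal in the complement. If the complement has an induced $2K_2$, adding
`v` to a vertex complete to it, or to an induced $P_3+K_2$, would give an excluded graph. So
`P4Uniform.not_inducedP3` applies to the complement without `v`, and `{v}` is a polar clique. -/
theorem hasPolarClique_of_isolated [Finite V] {G : SimpleGraph V} (h : P4Uniform G)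
    (h1 : FreeK1TwoK2 G) (h3 : FreeTwoK2JoinK2 Gᶜ) (h7 : FreeP3K2JoinK1 Gᶜ)
    {v : V} (hv : ∀ w, ¬ G.Adj v w) : HasPolarClique G := by
  have no2 : ∀ a b c d, ¬ InducedTwoK2 G a b c d := by
    intro a b c d hh
    have := h1 a b c d v hh
    simp [hv] at this
  by_cases h4 : ∀ a b c d, ¬ InducedTwoK2 Gᶜ a b c d
  · exact hasPolarClique_of_split (h.exists_split no2 h4)
  push Not at h4
  obtain ⟨a, b, c, d, h4⟩ := h4
  have hvadj : ∀ w, w ≠ v → Gᶜ.Adj v w := fun w hw => (compl_adj _ _ _).2 ⟨hw.symm, hv w⟩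
  have hne : ∀ {p q r s : V}, InducedTwoK2 Gᶜ p q r s → p ≠ v := by
    rintro p q r s hh rfl
    have h5 : r = p := by by_contra hc; exact hh.ac (hvadj r hc)
    exact hh.ad (h5 ▸ hh.cd)
  have ha := hne h4
  have hb := hne (⟨h4.ab.symm, h4.cd, h4.bc, h4.bd, h4.ac, h4.ad⟩ : InducedTwoK2 Gᶜ b a c d)
  have hc := hne h4.swap
  have hd := hne (⟨h4.cd.symm, h4.ab, mt Gᶜ.adj_symm h4.ad, mt Gᶜ.adj_symm h4.bd,
    mt Gᶜ.adj_symm h4.ac, mt Gᶜ.adj_symm h4.bc⟩ : InducedTwoK2 Gᶜ d c a b)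
  set X : Set V := {w | w ≠ v}
  have hU : P4Uniform (Gᶜ.induce X) := h.compl.induce X
  have hT : InducedTwoK2 (Gᶜ.induce X) ⟨a, ha⟩ ⟨b, hb⟩ ⟨c, hc⟩ ⟨d, hd⟩ :=
    ⟨h4.ab, h4.cd, h4.ac, h4.ad, h4.bc, h4.bd⟩
  have hP := hU.not_inducedP3 hT (by
    rintro ⟨w, hw⟩ ⟨e1, e2, e3, e4⟩
    refine h3 a b c d w v h4 ?_ (hvadj w hw).symm
    rintro p (rfl | rfl | rfl | rfl)
    exacts [⟨e1, hvadj _ ha⟩, ⟨e2, hvadj _ hb⟩, ⟨e3, hvadj _ hc⟩, ⟨e4, hvadj _ hd⟩]) (by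
    rintro ⟨p, hp⟩ ⟨q, hq⟩ ⟨r, hr⟩ ⟨s, hs⟩ ⟨t, ht⟩ ⟨e1, e2, e3, e4⟩ e5 e6
    refine h7 p q r s t v ⟨e1, e2, e3, by simpa using e4⟩ e5 ?_ ?_
    · simp at e6 ⊢
      exact e6
    · rintro x (rfl | rfl | rfl | rfl | rfl) <;> apply hvadj <;> assumption)
  refine ⟨{v}, by simp, ?_⟩
  intro x hx y hy z hz hxy hyz hxz
  have n1 : x ≠ y := by rintro rfl; exact hyz hxz
  have n2 : y ≠ z := by rintro rfl; exact hxy hxz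
  refine hP ⟨x, hx⟩ ⟨y, hy⟩ ⟨z, hz⟩ ⟨(compl_adj _ _ _).2 ⟨n1, hxy⟩, (compl_adj _ _ _).2 ⟨n2, hyz⟩,
    fun hc => ((compl_adj _ _ _).1 hc).2 hxz, ?_⟩
  exact fun hc => hxz.ne (congrArg Subtype.val hc)

theorem hasPolarClique_of_disconnects [Finite V] {G : SimpleGraph V} (h : P4Uniform G)
    (h1 : FreeK1TwoK2 G) (h2 : FreeTwoP3 G) (h3 : FreeTwoK2JoinK2 Gᶜ) (h7 : FreeP3K2JoinK1 Gᶜ)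
    (hd : Disconnects G) : HasPolarClique G := by
  by_cases hiso : ∃ v, ∀ w, ¬ G.Adj v w
  · obtain ⟨v, hv⟩ := hiso
    exact hasPolarClique_of_isolated h h1 h3 h7 hv
  push Not at hiso
  obtain ⟨X, ⟨x, hx⟩, ⟨y, hy⟩, hX⟩ := hd
  obtain ⟨x', hxx⟩ := hiso x
  obtain ⟨y', hyy⟩ := hiso y
  have hx' : x' ∈ X := by by_contra hc; exact hX x hx x' hc hxx
  have hy' : y' ∉ X := fun hc => hX y' hc y hy hyy.symm
  -- A failure of transitivity is an edge plus a vertex missing it; an edge on the other side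
  -- completes $K_1+2K_2$.
  have t1 : ∀ x ∈ X, ∀ y ∈ X, ∀ z ∈ X, ¬ G.Adj x y → ¬ G.Adj y z → ¬ G.Adj x z := by
    intro p hp q hq r hr e1 e2 e3
    rcases h1 p r y y' q ⟨e3, hyy, hX p hp y hy, hX p hp y' hy', hX r hr y hy, hX r hr y' hy'⟩
      with e | e | e | e
    exacts [e1 e.symm, e2 e, hX q hq y hy e, hX q hq y' hy' e]
  have t2 : ∀ x ∉ X, ∀ y ∉ X, ∀ z ∉ X, ¬ G.Adj x y → ¬ G.Adj y z → ¬ G.Adj x z := by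
    intro p hp q hq r hr e1 e2 e3
    rcases h1 x x' p r q ⟨hxx, e3, hX x hx p hp, hX x hx r hr, hX x' hx' p hp, hX x' hx' r hr⟩
      with e | e | e | e
    exacts [hX x hx q hq e.symm, hX x' hx' q hq e.symm, e1 e.symm, e2 e]
  by_cases hP : ∀ x ∈ X, ∀ y ∈ X, ∀ z ∈ X, ¬ InducedP3 G x y z
  · exact hasPolarClique_of_side t1 t2 ⟨x, hx, x', hx', hxx⟩ hP
  · push Not at hP
    obtain ⟨p, hp, q, hq, r, hr, hP⟩ := hP
    refine hasPolarClique_of_side (X := Xᶜ) t2 (by simpa using t1) ⟨y, hy, y', hy', hyy⟩ ?_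
    intro s hs t ht u hu hstu
    refine h2 p q r s t u hP hstu ?_
    rintro _ (rfl | rfl | rfl) _ (rfl | rfl | rfl) <;> apply hX <;> assumption

/-! ### Obstruction-free graphs are polar -/

/-- The four obstructions are excluded, the last two through complements. -/
structure ObstructionFree (G : SimpleGraph V) : Prop where
  uniform : P4Uniform G
  k1TwoK2 : FreeK1TwoK2 G
  twoP3 : FreeTwoP3 G
  c4TwoK1 : FreeTwoK2JoinK2 Gᶜ
  k1ComplP3K2 : FreeP3K2JoinK1 Gᶜ

theorem InducedTwoK2.of_induce {G : SimpleGraph V} {X : Set V} {a b c d : X}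
    (h : InducedTwoK2 (G.induce X) a b c d) : InducedTwoK2 G a b c d :=
  ⟨h.ab, h.cd, h.ac, h.ad, h.bc, h.bd⟩

theorem InducedP3.of_induce {G : SimpleGraph V} {X : Set V} {a b c : X}
    (h : InducedP3 (G.induce X) a b c) : InducedP3 G a b c :=
  ⟨h.ab, h.bc, h.ac, fun hc => h.ne (Subtype.ext hc)⟩

theorem compl_induce (G : SimpleGraph V) (X : Set V) : (G.induce X)ᶜ = Gᶜ.induce X := by
  ext a b
  simp [Subtype.ext_iff]

theorem ObstructionFree.induce {G : SimpleGraph V} (h : ObstructionFree G) (X : Set V) :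
    ObstructionFree (G.induce X) := by
  refine ⟨h.uniform.induce X, ?_, ?_, ?_, ?_⟩
  · intro a b c d v h2
    exact h.k1TwoK2 a b c d v h2.of_induce
  · intro a b c x y z h3 h3' h4
    refine h.twoP3 a b c x y z h3.of_induce h3'.of_induce ?_
    simpa using h4
  · rw [compl_induce]
    intro a b c d u v h2 h4
    refine h.c4TwoK1 a b c d u v h2.of_induce ?_
    simpa only [Set.mem_insert_iff, Set.mem_singleton_iff, forall_eq_or_imp, forall_eq,
      comap_adj, Function.Embedding.subtype_apply] using h4
  · rw [compl_induce]
    intro a b c d e v h3 hde h4 h5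
    refine h.k1ComplP3K2 a b c d e v h3.of_induce hde ?_ ?_
    · simpa only [Set.mem_insert_iff, Set.mem_singleton_iff, forall_eq_or_imp, forall_eq,
      comap_adj, Function.Embedding.subtype_apply] using h4
    · simpa only [Set.mem_insert_iff, Set.mem_singleton_iff, forall_eq_or_imp, forall_eq,
      comap_adj, Function.Embedding.subtype_apply] using h5

/-- In a join, the union of cliques of the two sides is a clique, and the parts left over on one
side are joined to those on the other. -/
theorem hasPolarClique_of_compl_disconnects {G : SimpleGraph V} {X : Set V}
    (hX : ∀ x ∈ X, ∀ y ∉ X, ¬ Gᶜ.Adj x y) (h1 : HasPolarClique (G.induce X))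
    (h2 : HasPolarClique (G.induce Xᶜ)) : HasPolarClique G := by
  obtain ⟨B, hB, hB'⟩ := h1
  obtain ⟨C, hC, hC'⟩ := h2
  have hadj : ∀ x ∈ X, ∀ y ∉ X, G.Adj x y := by
    intro x hx y hy
    by_contra hc
    exact hX x hx y hy ((compl_adj _ _ _).2 ⟨fun h => hy (h ▸ hx), hc⟩)
  have mB : ∀ x (hx : x ∈ X), x ∈ ((↑) '' B ∪ (↑) '' C : Set V) ↔ (⟨x, hx⟩ : X) ∈ B := by
    intro x hx
    simp [hx]
  have mC : ∀ x (hx : x ∉ X), x ∈ ((↑) '' B ∪ (↑) '' C : Set V) ↔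
      (⟨x, hx⟩ : (Xᶜ : Set V)) ∈ C := by
    intro x hx
    simp [hx]
  refine ⟨(↑) '' B ∪ (↑) '' C, ?_, ?_⟩
  · intro p hp q hq hpq
    by_cases hpX : p ∈ X <;> by_cases hqX : q ∈ X
    · rw [mB p hpX] at hp
      rw [mB q hqX] at hq
      exact hB hp hq (by simpa using hpq)
    · exact hadj p hpX q hqX
    · exact (hadj q hqX p hpX).symm
    · rw [mC p hpX] at hp
      rw [mC q hqX] at hq
      exact hC hp hq (by simpa using hpq)
  · intro x hx y hy z hz hxy hyz
    by_cases hyX : y ∈ X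
    · have hxX : x ∈ X := by by_contra hc; exact hxy (hadj y hyX x hc).symm
      have hzX : z ∈ X := by by_contra hc; exact hyz (hadj y hyX z hc)
      rw [mB _ ‹_›] at hx hy hz
      exact hB' _ hx _ hy _ hz hxy hyz
    · have hxX : x ∉ X := fun hc => hxy (hadj x hc y hyX)
      have hzX : z ∉ X := fun hc => hyz (hadj z hc y hyX).symm
      rw [mC _ ‹_›] at hx hy hz
      exact hC' _ hx _ hy _ hz hxy hyz

theorem ObstructionFree.hasPolarClique [Finite V] {G : SimpleGraph V} (h : ObstructionFree G) :
    HasPolarClique G := by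
  induction hn : Nat.card V using Nat.strong_induction_on generalizing V with
  | _ n ih =>
    have join : Disconnects Gᶜ → HasPolarClique G := by
      rintro ⟨X, ⟨x, hx⟩, ⟨y, hy⟩, hX⟩
      refine hasPolarClique_of_compl_disconnects hX
        (ih (Nat.card X) ?_ (h.induce X) rfl)
        (ih (Nat.card (Xᶜ : Set V)) ?_ (h.induce Xᶜ) rfl)
      · rw [← hn]
        exact Finite.card_subtype_lt (x := y) hy
      · rw [← hn]
        exact Finite.card_subtype_lt (x := x) (fun hc => hc hx)
    have disj := hasPolarClique_of_disconnects h.uniform h.k1TwoK2 h.twoP3 h.c4TwoK1 h.k1ComplP3K2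
    by_cases h2 : ∀ a b c d, ¬ InducedTwoK2 G a b c d
    · by_cases h4 : ∀ a b c d, ¬ InducedTwoK2 Gᶜ a b c d
      · exact hasPolarClique_of_split (h.uniform.exists_split h2 h4)
      · push Not at h4
        obtain ⟨a, b, c, d, h4⟩ := h4
        rcases h.c4TwoK1.disconnects h.uniform.compl h4 with h5 | h5
        · exact join h5
        · exact disj (by simpa using h5)
    · push Not at h2
      obtain ⟨a, b, c, d, h2⟩ := h2
      exact (h.k1TwoK2.disconnects h.uniform h2).elim disj join

/-! ### Polarity, heredity and minimality -/

theorem isPolar_top_one_iff {G : SimpleGraph V} : IsPolar ⊤ 1 G ↔ HasPolarClique G := by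
  constructor
  · rintro ⟨A, B, hAB, hd, ⟨hA, -⟩, ⟨hB, hc⟩⟩
    rw [ENat.card_le_one_iff_subsingleton] at hc
    have mA : ∀ x ∉ B, x ∈ A := fun x hx =>
      ((Set.mem_union _ _ _).1 (hAB ▸ Set.mem_univ x)).resolve_right hx
    refine ⟨B, ?_, ?_⟩
    · intro x hx y hy hxy
      have h1 : ¬ (G.induce B)ᶜ.Adj ⟨x, hx⟩ ⟨y, hy⟩ :=
        Quotient.exact (s := hB.setoid) (Subsingleton.elim _ _)
      simpa [hxy] using h1
    · intro x hx y hy z hz h1 h2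
      exact hA.trans ⟨x, mA x hx⟩ ⟨y, mA y hy⟩ ⟨z, mA z hz⟩ h1 h2
  · rintro ⟨B, hB, hM⟩
    have h1 : ∀ x y, ¬ (G.induce B)ᶜ.Adj x y := by
      rintro ⟨x, hx⟩ ⟨y, hy⟩ hxy
      simp only [compl_adj, ne_eq, Subtype.mk.injEq, comap_adj,
        Function.Embedding.subtype_apply] at hxy
      exact hxy.2 (hB hx hy hxy.1)
    refine ⟨Bᶜ, B, Set.compl_union_self B, disjoint_compl_left, ⟨⟨?_⟩, le_top⟩,
      ⟨⟨fun x y z _ _ => h1 x z⟩, ?_⟩⟩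
    · rintro ⟨x, hx⟩ ⟨y, hy⟩ ⟨z, hz⟩
      exact hM x hx y hy z hz
    · rw [ENat.card_le_one_iff_subsingleton]
      refine ⟨fun p q => ?_⟩
      induction p using Quotient.inductionOn
      induction q using Quotient.inductionOn
      exact Quotient.sound (h1 _ _)

theorem HasPolarClique.of_embedding {W : Type*} {H : SimpleGraph W} {G : SimpleGraph V}
    (f : H ↪g G) (h : HasPolarClique G) : HasPolarClique H := by
  obtain ⟨B, hB, hM⟩ := h
  refine ⟨f ⁻¹' B, fun x hx y hy hxy => ?_, fun x hx y hy z hz h1 h2 => ?_⟩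
  · exact f.map_adj_iff.1 (hB hx hy (f.injective.ne hxy))
  · rw [← f.map_adj_iff] at *
    exact hM _ hx _ hy _ hz h1 h2

theorem IsMinimalPolarObstruction.nonempty_iso {W : Type*} {H : SimpleGraph W} {G : SimpleGraph V}
    (hG : IsMinimalPolarObstruction ⊤ 1 G) (hH : ¬ HasPolarClique H) (f : H ↪g G) :
    Nonempty (G ≃g H) := by
  have hs : Set.range f = Set.univ := by
    by_contra hc
    exact hH ((isPolar_top_one_iff.1 (hG.2 _ hc)).of_embedding f.isoInduceRange.toEmbedding)
  exact ⟨(RelIso.ofSurjective f (Set.range_eq_univ.1 hs)).symm⟩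

/-- By heredity, deleting single vertices covers all proper induced subgraphs. -/
theorem isMinimalPolarObstruction_of_iso {W : Type*} {H : SimpleGraph W} {G : SimpleGraph V}
    (hH : ¬ HasPolarClique H) (hv : ∀ v, HasPolarClique (H.induce {v}ᶜ)) (e : G ≃g H) :
    IsMinimalPolarObstruction ⊤ 1 G := by
  refine ⟨fun h => hH ((isPolar_top_one_iff.1 h).of_embedding e.symm.toEmbedding), ?_⟩
  intro S hS
  obtain ⟨v, hvS⟩ := (Set.ne_univ_iff_exists_notMem S).1 hS
  have hne : ∀ x : S, e x ∈ ({e v}ᶜ : Set W) := by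
    intro x hx
    have : (x : V) = v := e.injective hx
    exact hvS (this ▸ x.2)
  obtain ⟨f, -⟩ := exists_embedding_of_adj_iff (H := G.induce S) (G := H.induce {e v}ᶜ)
    (fun x => ⟨e x, hne x⟩) (fun x y hxy => by simpa [Subtype.ext_iff] using hxy)
    (fun x y => e.map_adj_iff)
  exact isPolar_top_one_iff.2 ((hv (e v)).of_embedding f)

/-- Deleting a vertex, with the polar clique given by a Boolean function. -/
theorem hasPolarClique_delete {W : Type*} {H : SimpleGraph W} (v : W) (b : W → Bool)
    (h1 : ∀ x y, x ≠ v → y ≠ v → b x → b y → x ≠ y → H.Adj x y)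
    (h2 : ∀ x y, x ≠ v → y ≠ v → b x = false → b y = false → ¬ H.Adj x y → ∀ z, z ≠ v →
      b z = false → ¬ H.Adj y z → ¬ H.Adj x z) :
    HasPolarClique (H.induce {v}ᶜ) := by
  refine ⟨{x | b x}, ?_, ?_⟩
  · rintro ⟨x, hx⟩ hbx ⟨y, hy⟩ hby hxy
    exact h1 x y hx hy hbx hby (fun h => hxy (Subtype.ext h))
  · rintro ⟨x, hx⟩ hbx ⟨y, hy⟩ hby ⟨z, hz⟩ hbz h3 h4
    exact h2 x y hx hy (by simpa using hbx) (by simpa using hby) h3 z hz (by simpa using hbz) h4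

/-! ### The four graphs are minimal obstructions -/

instance decidableAdjSum {U W : Type*} (G : SimpleGraph U) (H : SimpleGraph W)
    [DecidableRel G.Adj] [DecidableRel H.Adj] : DecidableRel (G ⊕g H).Adj
  | .inl x, .inl y => decidable_of_iff (G.Adj x y) sum_adj_inl.symm
  | .inr x, .inr y => decidable_of_iff (H.Adj x y) sum_adj_inr.symm
  | .inl _, .inr _ => .isFalse (by simp)
  | .inr _, .inl _ => .isFalse (by simp)

instance decidableAdjPathGraph (n : ℕ) : DecidableRel (pathGraph n).Adj :=
  fun _ _ => decidable_of_iff _ pathGraph_adj.symm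

instance decidableAdjE1 : DecidableRel E1.Adj :=
  inferInstanceAs (DecidableRel (_ ⊕g (_ ⊕g _)).Adj)

instance decidableAdjE2 : DecidableRel E2.Adj :=
  inferInstanceAs (DecidableRel (_ ⊕g _).Adj)

instance decidableAdjE3 : DecidableRel E3.Adj :=
  inferInstanceAs (DecidableRel (_ ⊕g (_ ⊕g _)).Adj)

instance decidableAdjE7 : DecidableRel E7.Adj :=
  inferInstanceAs (DecidableRel (_ ⊕g (_ ⊕g _)ᶜ).Adj)

set_option maxRecDepth 10000
set_option synthInstance.maxHeartbeats 200000
set_option synthInstance.maxSize 2000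

theorem E1_delete : ∀ v, HasPolarClique (E1.induce {v}ᶜ) := by
  intro v
  apply hasPolarClique_delete v (Sum.elim (fun _ => false) (Sum.elim
    (fun _ => v ≠ .inr (.inl 0) ∧ v ≠ .inr (.inl 1))
    (fun _ => v = .inr (.inl 0) ∨ v = .inr (.inl 1))))
  · revert v; decide
  · revert v; decide

theorem E2_delete : ∀ v, HasPolarClique (E2.induce {v}ᶜ) := by
  intro v
  -- Without a midpoint, an edge of the other path leaves an edgeless graph. Without an end, the
  -- remaining edge of that path leaves the other $P_3$.
  apply hasPolarClique_delete v (match v with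
    | .inl 1 => Sum.elim (fun _ => false) (fun x => x ≠ 2)
    | .inr 1 => Sum.elim (fun x => x ≠ 2) (fun _ => false)
    | .inl _ => Sum.elim (fun _ => true) (fun _ => false)
    | .inr _ => Sum.elim (fun _ => false) (fun _ => true))
  · revert v; decide
  · revert v; decide

theorem E3_delete : ∀ v, HasPolarClique (E3.induce {v}ᶜ) := by
  intro v
  -- Without a cycle vertex, an edge of the cycle leaves an edgeless graph; without an isolated
  -- vertex, the other one leaves $C_4$.
  apply hasPolarClique_delete v (match v with
    | .inl i => Sum.elim (fun x => x = i + 1 ∨ x = i + 2) (fun _ => false)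
    | .inr _ => Sum.elim (fun _ => false) (fun _ => true))
  · revert v; decide
  · revert v; decide

theorem E7_delete : ∀ v, HasPolarClique (E7.induce {v}ᶜ) := by
  intro v
  -- The clique leaves $C_4$ when `v` is the isolated vertex or an end of the $P_3$, and an edgeless
  -- graph otherwise.
  apply hasPolarClique_delete v (match v with
    | .inl _ => Sum.elim (fun _ => false) (Sum.elim (fun x => x = 0) (fun _ => false))
    | .inr (.inl 1) => Sum.elim (fun _ => false) (Sum.elim (fun x => x ≠ 1) (fun _ => false))
    | .inr (.inl _) => Sum.elim (fun _ => true) (fun _ => false)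
    | .inr (.inr _) => Sum.elim (fun _ => false) (Sum.elim (fun x => x ≠ 1) (fun _ => true)))
  · revert v; decide
  · revert v; decide

/-- The adjacency conditions stand in front, so that `decide` settles them on concrete graphs and
only membership in `B` is left to refute. -/
theorem HasPolarClique.exists_set {G : SimpleGraph V} (h : HasPolarClique G) : ∃ B : Set V,
    (∀ x y, x ≠ y ∧ ¬ G.Adj x y → x ∈ B → y ∉ B) ∧
    ∀ x y z, ¬ G.Adj x y ∧ ¬ G.Adj y z ∧ G.Adj x z → x ∈ B ∨ y ∈ B ∨ z ∈ B := by
  obtain ⟨B, hB, hM⟩ := h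
  refine ⟨B, fun x y h hx hy => h.2 (hB hx hy h.1), ?_⟩
  rintro x y z ⟨h1, h2, h3⟩
  by_contra! hc
  exact hM x hc.1 y hc.2.1 z hc.2.2 h1 h2 h3

theorem E1_not_hasPolarClique : ¬ HasPolarClique E1 := by
  intro h
  obtain ⟨B, c, m⟩ := h.exists_set
  have c1 := fun i => c (.inl 0) (.inr (.inl i)) (by revert i; decide)
  have c2 := fun i => c (.inl 0) (.inr (.inr i)) (by revert i; decide)
  have c3 := fun i j => c (.inr (.inl i)) (.inr (.inr j)) (by revert i j; decide)
  have m1 := m (.inr (.inl 0)) (.inl 0) (.inr (.inl 1)) (by decide)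
  have m2 := m (.inr (.inr 0)) (.inl 0) (.inr (.inr 1)) (by decide)
  have m3 := fun i => m (.inr (.inl 0)) (.inr (.inr i)) (.inr (.inl 1)) (by revert i; decide)
  have m4 := fun i => m (.inr (.inr 0)) (.inr (.inl i)) (.inr (.inr 1)) (by revert i; decide)
  grind

theorem E2_not_hasPolarClique : ¬ HasPolarClique E2 := by
  intro h
  obtain ⟨B, c, m⟩ := h.exists_set
  have c1 := fun i j => c (.inl i) (.inr j) (by revert i j; decide)
  have c2 := c (.inl 0) (.inl 2) (by decide)
  have c3 := c (.inr 0) (.inr 2) (by decide)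
  have m1 := fun i => m (.inl 0) (.inr i) (.inl 1) (by revert i; decide)
  have m2 := fun i => m (.inr 0) (.inl i) (.inr 1) (by revert i; decide)
  grind

theorem E3_not_hasPolarClique : ¬ HasPolarClique E3 := by
  intro h
  obtain ⟨B, c, m⟩ := h.exists_set
  have c1 := fun i j => c (.inl i) (.inr j) (by revert i j; decide)
  have c2 := c (.inl 0) (.inl 2) (by decide)
  have c3 := c (.inl 1) (.inl 3) (by decide)
  have c4 := c (.inr (.inl 0)) (.inr (.inr 0)) (by decide)
  have m1 := fun i => m (.inl 0) (.inr i) (.inl 1) (by revert i; decide)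
  have m2 := fun i => m (.inl 1) (.inr i) (.inl 2) (by revert i; decide)
  have m3 := fun i => m (.inl 2) (.inr i) (.inl 3) (by revert i; decide)
  have m4 := fun i => m (.inl 3) (.inr i) (.inl 0) (by revert i; decide)
  grind

theorem E7_not_hasPolarClique : ¬ HasPolarClique E7 := by
  intro h
  obtain ⟨B, c, m⟩ := h.exists_set
  have c1 := fun i => c (.inl 0) (.inr i) (by revert i; decide)
  have c2 := c (.inr (.inl 0)) (.inr (.inl 1)) (by decide)
  have c3 := c (.inr (.inr 0)) (.inr (.inr 1)) (by decide)
  have m1 := m (.inr (.inl 0)) (.inr (.inl 1)) (.inr (.inl 2)) (by decide)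
  have m2 := fun i j => m (.inr (.inl i)) (.inl 0) (.inr (.inr j)) (by revert i j; decide)
  grind

/-! ### The four graphs are cographs -/

theorem IsCograph.completeGraph_one : IsCograph (completeGraph (Fin 1)) := .trivial _

theorem IsCograph.completeGraph_two : IsCograph (completeGraph (Fin 2)) :=
  .iso (G := (completeGraph (Fin 1) ⊕g completeGraph (Fin 1))ᶜ)
    ⟨finSumFinEquiv, by decide⟩ (.compl (.disjUnion completeGraph_one completeGraph_one))

/-- The vertices `0`, `2` and `1` of the path on three vertices, as a sum. -/
def pathGraphThreeEquiv : Fin 2 ⊕ Fin 1 ≃ Fin 3 where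
  toFun := Sum.elim ![0, 2] ![1]
  invFun := ![.inl 0, .inr 0, .inl 1]
  left_inv := by decide
  right_inv := by decide

theorem IsCograph.pathGraph_three : IsCograph (pathGraph 3) :=
  .iso (G := (completeGraph (Fin 2) ⊕g completeGraph (Fin 1))ᶜ)
    ⟨pathGraphThreeEquiv, by decide⟩ (.compl (.disjUnion completeGraph_two completeGraph_one))

/-- The two pairs of opposite vertices of the cycle on four vertices. -/
def cycleGraphFourEquiv : Fin 2 ⊕ Fin 2 ≃ Fin 4 where
  toFun := Sum.elim ![0, 2] ![1, 3]
  invFun := ![.inl 0, .inr 0, .inl 1, .inr 1]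
  left_inv := by decide
  right_inv := by decide

theorem IsCograph.cycleGraph_four : IsCograph (cycleGraph 4) :=
  .iso (G := (completeGraph (Fin 2) ⊕g completeGraph (Fin 2))ᶜ)
    ⟨cycleGraphFourEquiv, by decide⟩ (.compl (.disjUnion completeGraph_two completeGraph_two))

/-! ### Embedding the excluded configurations -/

theorem exists_embedding_E1 {G : SimpleGraph V} (h : ¬ FreeK1TwoK2 G) : Nonempty (E1 ↪g G) := by
  simp only [FreeK1TwoK2, not_forall, not_or] at h
  obtain ⟨a, b, c, d, v, ⟨h1, h2, h3, h4, h5, h6⟩, h7, h8, h9, h10⟩ := h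
  obtain ⟨f, -⟩ := exists_embedding_of_adj_iff (H := E1) (G := G)
    (Sum.elim ![v] (Sum.elim ![a, b] ![c, d])) (by
      simp [Fin.forall_fin_succ]
      grind (splits := 60) [G.adj_comm, G.loopless.irrefl]) (by
      simp [Fin.forall_fin_succ, E1]
      grind (splits := 60) [G.adj_comm, G.loopless.irrefl])
  exact ⟨f⟩

theorem exists_embedding_E2 {G : SimpleGraph V} (h : ¬ FreeTwoP3 G) : Nonempty (E2 ↪g G) := by
  simp only [FreeTwoP3, not_forall, Set.mem_insert_iff, Set.mem_singleton_iff, forall_eq_or_imp,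
    forall_eq] at h
  obtain ⟨a, b, c, x, y, z, ⟨h1, h2, h3, h4⟩, ⟨k1, k2, k3, k4⟩, h5, -⟩ := h
  obtain ⟨f, -⟩ := exists_embedding_of_adj_iff (H := E2) (G := G)
    (Sum.elim ![a, b, c] ![x, y, z]) (by
      simp [Fin.forall_fin_succ]
      grind (splits := 60) [G.adj_comm, G.loopless.irrefl]) (by
      simp [Fin.forall_fin_succ, E2, pathGraph_adj]
      grind (splits := 60) [G.adj_comm, G.loopless.irrefl])
  exact ⟨f⟩

theorem exists_embedding_E3 {G : SimpleGraph V} (h : ¬ FreeTwoK2JoinK2 Gᶜ) :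
    Nonempty (E3 ↪g G) := by
  simp only [FreeTwoK2JoinK2, not_forall, not_not, Set.mem_insert_iff, Set.mem_singleton_iff,
    forall_eq_or_imp, forall_eq] at h
  obtain ⟨a, b, c, d, u, v, ⟨h1, h2, h3, h4, h5, h6⟩, h7, h8⟩ := h
  have n1 : a ≠ c := by rintro rfl; exact h4 h2
  have n2 : a ≠ d := by rintro rfl; exact h3 h2.symm
  have n3 : b ≠ c := by rintro rfl; exact h6 h2
  have n4 : b ≠ d := by rintro rfl; exact h5 h2.symm
  simp only [compl_adj] at *
  obtain ⟨f, -⟩ := exists_embedding_of_adj_iff (H := E3) (G := G)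
    -- The edges `ab` and `cd` of the complement are the diagonals of the $C_4$, hence the order.
    (Sum.elim ![a, c, b, d] (Sum.elim ![u] ![v])) (by
      simp [Fin.forall_fin_succ]
      grind (splits := 60)) (by
      simp [Fin.forall_fin_succ, E3, cycleGraph_adj]
      grind (splits := 60) [G.adj_comm, G.loopless.irrefl])
  exact ⟨f⟩

theorem exists_embedding_E7 {G : SimpleGraph V} (h : ¬ FreeP3K2JoinK1 Gᶜ) :
    Nonempty (E7 ↪g G) := by
  simp only [FreeP3K2JoinK1, not_forall, not_not, Set.mem_insert_iff, Set.mem_singleton_iff,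
    forall_eq_or_imp, forall_eq] at h
  obtain ⟨a, b, c, d, e, v, ⟨h1, h2, h3, h4⟩, h5, h6, h7⟩ := h
  have n1 : ∀ x, ¬ Gᶜ.Adj x d → ¬ Gᶜ.Adj x e → x ≠ d ∧ x ≠ e := by
    intro x hd he
    constructor
    · rintro rfl; exact he h5
    · rintro rfl; exact hd h5.symm
  have na := n1 a h6.1.1 h6.1.2
  have nb := n1 b h6.2.1.1 h6.2.1.2
  have nc := n1 c h6.2.2.1 h6.2.2.2
  clear n1
  simp only [compl_adj] at *
  obtain ⟨f, -⟩ := exists_embedding_of_adj_iff (H := E7) (G := G)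
    (Sum.elim ![v] (Sum.elim ![a, b, c] ![d, e])) (by
      simp [Fin.forall_fin_succ]
      grind (splits := 60)) (by
      simp [Fin.forall_fin_succ, E7, pathGraph_adj]
      grind (splits := 60) [G.adj_comm, G.loopless.irrefl])
  exact ⟨f⟩

end P4Polar

theorem mainTheorem8 {V : Type*} [Finite V] (G : SimpleGraph V) (hG : P4Polar.IsP4Sparse G) :
    (P4Polar.IsMinimalPolarObstruction ⊤ 1 G ↔
      Nonempty (G ≃g P4Polar.E1) ∨ Nonempty (G ≃g P4Polar.E2) ∨
        Nonempty (G ≃g P4Polar.E3) ∨ Nonempty (G ≃g P4Polar.E7)) ∧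
    (P4Polar.IsCograph P4Polar.E1 ∧ P4Polar.IsCograph P4Polar.E2 ∧
      P4Polar.IsCograph P4Polar.E3 ∧ P4Polar.IsCograph P4Polar.E7) := by
  open P4Polar in
  refine ⟨⟨fun h => ?_, ?_⟩, ?_, ?_, ?_, ?_⟩
  · by_contra hc
    simp only [not_or] at hc
    refine h.1 (isPolar_top_one_iff.2 (ObstructionFree.hasPolarClique
      ⟨hG.p4Uniform, ?_, ?_, ?_, ?_⟩)) <;> by_contra hn
    · obtain ⟨f⟩ := exists_embedding_E1 hn
      exact hc.1 (h.nonempty_iso E1_not_hasPolarClique f)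
    · obtain ⟨f⟩ := exists_embedding_E2 hn
      exact hc.2.1 (h.nonempty_iso E2_not_hasPolarClique f)
    · obtain ⟨f⟩ := exists_embedding_E3 hn
      exact hc.2.2.1 (h.nonempty_iso E3_not_hasPolarClique f)
    · obtain ⟨f⟩ := exists_embedding_E7 hn
      exact hc.2.2.2 (h.nonempty_iso E7_not_hasPolarClique f)
  · rintro (⟨⟨e⟩⟩ | ⟨⟨e⟩⟩ | ⟨⟨e⟩⟩ | ⟨⟨e⟩⟩)
    · exact isMinimalPolarObstruction_of_iso E1_not_hasPolarClique E1_delete e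
    · exact isMinimalPolarObstruction_of_iso E2_not_hasPolarClique E2_delete e
    · exact isMinimalPolarObstruction_of_iso E3_not_hasPolarClique E3_delete e
    · exact isMinimalPolarObstruction_of_iso E7_not_hasPolarClique E7_delete e
  · exact .disjUnion .completeGraph_one (.disjUnion .completeGraph_two .completeGraph_two)
  · exact .disjUnion .pathGraph_three .pathGraph_three
  · exact .disjUnion .cycleGraph_four (.disjUnion .completeGraph_one .completeGraph_one)
  · exact .disjUnion .completeGraph_one
      (.compl (.disjUnion .pathGraph_three .completeGraph_two))
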